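/- Let $C=[-\tfrac12,\tfrac12]^3$ be the unit cube, centred at the origin. A \emph{three-dimensional Hilbert curve} is a continuous map $\tau$ from $[0,1]$ onto $C$ that is octant-based and self-similar, that is: there are an ordering $C_1,\dots,C_8$ of the eight octants (subcubes of side $\tfrac12$) of $C$ and, for each $i\in\{1,\dots,8\}$, a symmetry $\gamma_i$ of $C$ (a signed permutation of the coordinates) and a direction function $\chi_i$, where either $\chi_i(t)=t$ for all $t\in[0,1]$ or $\chi_i(t)=1-t$ for all $t\in[0,1]$, such that \[ \tau\Bigl(\frac{i-1+t}{8}\Bigr)=\rho_i\bigl(\gamma_i(\tau(\chi_i(t)))\bigr)\qquad\text{for all } i\in\{1,\dots,8\},\ t\in[0,1], \] where $\rho_i$ is the scaling by $\tfrac12$ followed by the translation that maps $C$ onto $C_i$. The curve $\tau$ is \emph{face-continuous} if for all $0\le a<b\le 1$ the interior of the set $\tau([a,b])$ is connected. For $k\ge 0$, the \emph{$k$-th-order approximating curve} $A_k$ of $\tau$ is the polygonal curve with $8^k$ vertices and $8^k-1$ edges that connects the centres of the $8^k$ cubes of the regular $2^k\times2^k\times2^k$ grid subdividing $C$, in the order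 in which they are traversed by $\tau$; its $i$-th vertex is the centre of the grid cube $\tau\bigl([(i-1)8^{-k},\,i\,8^{-k}]\bigr)$. For $j\in\{1,2,3\}$ let $e_j(k)$ be the number of edges of $A_k$ that are parallel to the $j$-th coordinate axis. A face-continuous Hilbert curve $\tau$ is \emph{edge-isotropic} if, in the limit, there is an equal number of edges of $A_k$ parallel to each axis, that is, \[ \lim_{k\to\infty}\frac{e_j(k)}{8^k-1}=\frac13\qquad\text{for each } j\in\{1,2,3\}. \] \textbf{Theorem.} Every face-continuous three-dimensional Hilbert curve is edge-isotropic. -/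

import Mathlib

open Set Filter Topology

namespace HilbertCurve

/-- The unit cube in dimension `d`, centred at the origin. -/
def unitCube (d : ℕ) : Set (Fin d → ℝ) :=
  {x | ∀ j, -(1 / 2) ≤ x j ∧ x j ≤ 1 / 2}

/-- A symmetry of the unit cube, given as a signed permutation of the coordinate axes:
the `j`-th axis is mapped to the axis `perm j`, with the sign `sign j`. -/
structure SignedPerm (d : ℕ) where
  perm : Equiv.Perm (Fin d)
  sign : Fin d → ℤˣ

/-- The action of a signed permutation on points. In its matrix the only non-zero entry of
column `j` is `sign j`, in row `perm j`. -/
def SignedPerm.act {d : ℕ} (γ : SignedPerm d) (x : Fin d → ℝ) : Fin d → ℝ :=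
  fun l => ((γ.sign (γ.perm.symm l) : ℤ) : ℝ) * x (γ.perm.symm l)

/-- The map that scales the unit cube by `1 / 2` and translates it onto one of its `2 ^ d`
first-level subcubes. The subcube is given by the signs of the coordinates of its centre. -/
noncomputable def toSubcube {d : ℕ} (o : Fin d → ℤˣ) (x : Fin d → ℝ) : Fin d → ℝ :=
  fun j => ((o j : ℤ) : ℝ) / 4 + x j / 2

/-- The data defining a self-similar traversal of the cube: the order in which the `2 ^ d`
subcubes are visited, and for each of them a symmetry of the cube and a direction. -/
structure TraversalData (d : ℕ) where
  subcube : Fin (2 ^ d) ≃ (Fin d → ℤˣ)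
  symmetry : Fin (2 ^ d) → SignedPerm d
  reversed : Fin (2 ^ d) → Bool

/-- The direction function of the `i`-th subcube: `t` if the subcube is traversed forward,
`1 - t` if it is traversed in reverse. -/
def TraversalData.direction {d : ℕ} (D : TraversalData d) (i : Fin (2 ^ d)) (t : ℝ) : ℝ :=
  if D.reversed i then 1 - t else t

/-- `τ` traverses the cube self-similarly according to the data `D`: on the `i`-th of the
`2 ^ d` equal parts of `[0, 1]` (indices starting from `0`), it is the copy of the whole
traversal that the data prescribe for the `i`-th visited subcube. -/
def IsSelfSimilar {d : ℕ} (τ : ℝ → Fin d → ℝ) (D : TraversalData d) : Prop :=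
  ∀ i : Fin (2 ^ d), ∀ t ∈ Icc (0 : ℝ) 1,
    τ (((i : ℕ) + t) / 2 ^ d) =
      toSubcube (D.subcube i) ((D.symmetry i).act (τ (D.direction i t)))

/-- A `d`-dimensional Hilbert curve: a continuous self-similar traversal `[0, 1] → [0, 1] ^ d`
(up to translation) of the whole cube, subcube by subcube. Only the values of `τ` on `[0, 1]`
matter. -/
def IsHilbertCurve {d : ℕ} (τ : ℝ → Fin d → ℝ) : Prop :=
  ContinuousOn τ (Icc 0 1) ∧ τ '' Icc 0 1 = unitCube d ∧
    ∃ D : TraversalData d, IsSelfSimilar τ D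

/-- Face-continuity: the interior of the region filled by any section of the curve is
connected. -/
def IsFaceContinuous {d : ℕ} (τ : ℝ → Fin d → ℝ) : Prop :=
  ∀ a b : ℝ, 0 ≤ a → a < b → b ≤ 1 → IsConnected (interior (τ '' Icc a b))

/-- The `i`-th of the `2 ^ (k * d)` equal segments of `[0, 1]` (indices starting from `0`). -/
def timeSegment (d k i : ℕ) : Set ℝ :=
  Icc ((i : ℝ) / 2 ^ (k * d)) (((i : ℝ) + 1) / 2 ^ (k * d))

/-- The cubes of the regular grid of `2 ^ (k * d)` subcubes of the unit cube. -/
def gridCube {d : ℕ} (k : ℕ) (g : Fin d → Fin (2 ^ k)) : Set (Fin d → ℝ) :=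
  {x | ∀ j, -(1 / 2) + ((g j : ℕ) : ℝ) / 2 ^ k ≤ x j ∧
    x j ≤ -(1 / 2) + (((g j : ℕ) : ℝ) + 1) / 2 ^ k}

/-- The centre of a grid cube. -/
noncomputable def gridCentre {d : ℕ} (k : ℕ) (g : Fin d → Fin (2 ^ k)) : Fin d → ℝ :=
  fun j => -(1 / 2) + (((g j : ℕ) : ℝ) + 1 / 2) / 2 ^ k

/-- `p` is the `i`-th vertex of the `k`-th-order approximating curve of `τ`: the centre of
the grid cube that `τ` fills during the `i`-th of the `2 ^ (k * d)` time segments. -/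
def IsApproxVertex {d : ℕ} (τ : ℝ → Fin d → ℝ) (k i : ℕ) (p : Fin d → ℝ) : Prop :=
  ∃ g : Fin d → Fin (2 ^ k), τ '' timeSegment d k i = gridCube k g ∧ p = gridCentre k g

/-- The vector `v` is non-zero and parallel to the `j`-th coordinate axis. -/
def IsParallelToAxis {d : ℕ} (j : Fin d) (v : Fin d → ℝ) : Prop :=
  v j ≠ 0 ∧ ∀ l, l ≠ j → v l = 0

/-- The number of edges of the `k`-th-order approximating curve (the polygonal curve through
its `2 ^ (k * d)` vertices in order) that are parallel to the `j`-th axis. -/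
noncomputable def axisEdgeCount {d : ℕ} (τ : ℝ → Fin d → ℝ) (k : ℕ) (j : Fin d) : ℕ :=
  Set.ncard {i : ℕ | i + 1 < 2 ^ (k * d) ∧ ∃ p q : Fin d → ℝ,
    IsApproxVertex τ k i p ∧ IsApproxVertex τ k (i + 1) q ∧ IsParallelToAxis j (q - p)}

/-- Edge-isotropy (of a face-continuous Hilbert curve): for each axis, the fraction of the
`2 ^ (k * d) - 1` edges of the `k`-th-order approximating curve that are parallel to that axis
tends to `1 / d`. -/
def IsEdgeIsotropic {d : ℕ} (τ : ℝ → Fin d → ℝ) : Prop :=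
  ∀ j : Fin d, Tendsto (fun k : ℕ => (axisEdgeCount τ k j : ℝ) / ((2 : ℝ) ^ (k * d) - 1))
    atTop (𝓝 (1 / (d : ℝ)))

end HilbertCurve

namespace HilbertCurve

/-! Let x_k(j) be the number of edges of A_k parallel to axis j, divided by 8^k. By self-similarity,
A_{k+1} consists of eight signed-permuted copies of A_k joined by seven edges, so x_{k+1} is, up to
O(8^{-k}), the average of eight coordinate permutations of x_k (`axisEdgeCount_succ`).
Face-continuity makes every edge axis-parallel, so the counts add up to 8^k - 1, and it suffices
that the differences between the coordinates of x_k tend to 0.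

Averaging twice shrinks these differences by the factor 63/64, up to the error, unless some
coordinate of the two-step average merely copies one coordinate. For permutations of three axes this
forces the eight of them to have a common fixed axis or to be all equal (`tendsto_sub_of_average`,
`perm_fixed_or_const`).

Face-continuity excludes both cases. Successive octants share a face, and at every scale the last
cell of one and the first cell of the next face each other across it. Only the signs of these
positions matter (`GateSigns`). By parity, the first and last octants differ in one or three
coordinates; `GateSigns.not_all_neg` excludes three. An axis along which entry and exit agree in
every octant has all its gates next to the centre, whereas a step along an axis requires an end of
the curve on the outer boundary along the pulled-back axis. With a common fixed axis or equal
permutations, this either is a direct contradiction or makes all seven steps parallel, which cannot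
reach eight octants (`GateSigns.not_fixed`, `GateSigns.not_const`). -/

/-! ### Grid cubes under the symmetries of the cube -/

lemma mem_gridCube_iff {d k : ℕ} (g : Fin d → Fin (2 ^ k)) (x : Fin d → ℝ) :
    x ∈ gridCube k g ↔ ∀ j, |x j - gridCentre k g j| ≤ 1 / 2 ^ (k + 1) := by
  have h : ∀ j, gridCentre k g j =
      -(1 / 2) + ((g j : ℕ) : ℝ) / 2 ^ k + 1 / 2 ^ (k + 1) ∧
      (((g j : ℕ) : ℝ) + 1) / 2 ^ k = ((g j : ℕ) : ℝ) / 2 ^ k + 2 * (1 / 2 ^ (k + 1)) := by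
    intro j
    unfold gridCentre
    constructor <;> field_simp <;> ring
  simp only [gridCube, mem_ofPred_eq]
  refine forall_congr' fun j => ?_
  rw [abs_le, (h j).1, (h j).2]
  constructor
  · rintro ⟨h1, h2⟩
    constructor <;> linarith
  · rintro ⟨h1, h2⟩
    constructor <;> linarith

lemma abs_gridCentre_le {d k : ℕ} (g : Fin d → Fin (2 ^ k)) (j : Fin d) :
    |gridCentre k g j| ≤ 1 / 2 - 1 / 2 ^ (k + 1) := by
  have h1 : (((g j : ℕ) : ℝ) + 1) ≤ 2 ^ k := by exact_mod_cast (g j).2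
  have h2 : (0 : ℝ) ≤ ((g j : ℕ) : ℝ) := by positivity
  have h3 : (0 : ℝ) < 2 ^ k := by positivity
  have h4 : (((g j : ℕ) : ℝ) + 1) / 2 ^ k ≤ 1 := by rw [div_le_one h3]; exact h1
  have h5 : gridCentre k g j = -(1 / 2) + (((g j : ℕ) : ℝ) + 1) / 2 ^ k - 1 / 2 ^ (k + 1) := by
    unfold gridCentre; field_simp; ring
  have h6 : gridCentre k g j = -(1 / 2) + ((g j : ℕ) : ℝ) / 2 ^ k + 1 / 2 ^ (k + 1) := by
    unfold gridCentre; field_simp; ring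
  have h7 : 0 ≤ ((g j : ℕ) : ℝ) / 2 ^ k := by positivity
  rw [abs_le]
  constructor <;> linarith

lemma gridCube_injective {d k : ℕ} {g g' : Fin d → Fin (2 ^ k)}
    (h : gridCube k g = gridCube k g') : g = g' := by
  have key : ∀ g g' : Fin d → Fin (2 ^ k), gridCube k g = gridCube k g' →
      ∀ j, (g' j : ℕ) ≤ (g j : ℕ) := by
    intro g g' h j
    have hm : (fun j => -(1 / 2) + ((g j : ℕ) : ℝ) / 2 ^ k) ∈ gridCube k g := by
      intro l
      refine ⟨le_rfl, ?_⟩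
      have : ((g l : ℕ) : ℝ) / 2 ^ k ≤ (((g l : ℕ) : ℝ) + 1) / 2 ^ k := by
        gcongr
        linarith
      simpa using this
    rw [h] at hm
    have h3 : (0 : ℝ) < 2 ^ k := by positivity
    have := (hm j).1
    have h4 : ((g' j : ℕ) : ℝ) / 2 ^ k ≤ ((g j : ℕ) : ℝ) / 2 ^ k := by linarith
    rw [div_le_div_iff_of_pos_right h3] at h4
    exact_mod_cast h4
  funext j
  exact Fin.ext (le_antisymm (key g' g h.symm j) (key g g' h j))

lemma IsApproxVertex.unique {d : ℕ} {τ : ℝ → Fin d → ℝ} {k i : ℕ} {p q : Fin d → ℝ}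
    (hp : IsApproxVertex τ k i p) (hq : IsApproxVertex τ k i q) : p = q := by
  obtain ⟨g, hg, rfl⟩ := hp
  obtain ⟨g', hg', rfl⟩ := hq
  rw [gridCube_injective (hg.symm.trans hg')]

lemma units_cast_cases (s : ℤˣ) : (((s : ℤ) : ℝ) = 1) ∨ (((s : ℤ) : ℝ) = -1) := by
  rcases Int.units_eq_one_or s with h | h <;> simp [h]

lemma abs_units_cast (s : ℤˣ) : |((s : ℤ) : ℝ)| = 1 := by
  rcases units_cast_cases s with h | h <;> simp [h]

lemma SignedPerm.act_perm {d : ℕ} (γ : SignedPerm d) (x : Fin d → ℝ) (j : Fin d) :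
    γ.act x (γ.perm j) = ((γ.sign j : ℤ) : ℝ) * x j := by
  simp [SignedPerm.act]

lemma SignedPerm.abs_act {d : ℕ} (γ : SignedPerm d) (x : Fin d → ℝ) (j : Fin d) :
    |γ.act x j| = |x (γ.perm.symm j)| := by
  simp only [SignedPerm.act]
  rw [abs_mul, abs_units_cast, one_mul]

lemma SignedPerm.act_sub {d : ℕ} (γ : SignedPerm d) (x y : Fin d → ℝ) :
    γ.act (x - y) = γ.act x - γ.act y := by
  funext j
  simp only [SignedPerm.act, Pi.sub_apply]
  ring

lemma SignedPerm.act_injective {d : ℕ} (γ : SignedPerm d) : Function.Injective γ.act := by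
  intro x y h
  funext j
  have := congrFun h (γ.perm j)
  rw [act_perm, act_perm] at this
  rcases units_cast_cases (γ.sign j) with h | h <;> rw [h] at this <;> linarith

lemma exists_gridCentre_coord {k : ℕ} (g : Fin (2 ^ k)) (s s' : ℤˣ) :
    ∃ g' : Fin (2 ^ (k + 1)), -(1 / 2) + (((g' : ℕ) : ℝ) + 1 / 2) / 2 ^ (k + 1) =
      ((s : ℤ) : ℝ) / 4 + ((s' : ℤ) : ℝ) * (-(1 / 2) + (((g : ℕ) : ℝ) + 1 / 2) / 2 ^ k) / 2 := by
  have hg := g.2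
  have hp : 2 ^ (k + 1) = 2 * 2 ^ k := by ring
  have h3 : (2 : ℝ) ^ k ≠ 0 := by positivity
  have hc : ((2 ^ k - 1 - (g : ℕ) : ℕ) : ℝ) = 2 ^ k - 1 - (g : ℕ) := by
    rw [Nat.sub_sub, Nat.cast_sub (by omega)]
    push_cast
    ring
  rcases units_cast_cases s with h | h <;> rcases units_cast_cases s' with h' | h' <;>
    rw [h, h']
  · refine ⟨⟨g + 2 ^ k, by omega⟩, ?_⟩
    push_cast; field_simp; ring
  · refine ⟨⟨(2 ^ k - 1 - g) + 2 ^ k, by omega⟩, ?_⟩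
    push_cast; rw [hc]; field_simp; ring
  · refine ⟨⟨g, by omega⟩, ?_⟩
    push_cast; field_simp; ring
  · refine ⟨⟨2 ^ k - 1 - g, by omega⟩, ?_⟩
    push_cast; rw [hc]; field_simp; ring

lemma exists_gridCentre_toSubcube {d k : ℕ} (o : Fin d → ℤˣ) (γ : SignedPerm d)
    (g : Fin d → Fin (2 ^ k)) :
    ∃ g' : Fin d → Fin (2 ^ (k + 1)),
      gridCentre (k + 1) g' = toSubcube o (γ.act (gridCentre k g)) := by
  choose f hf using fun l => exists_gridCentre_coord (g (γ.perm.symm l)) (o l)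
    (γ.sign (γ.perm.symm l))
  exact ⟨f, funext fun l => hf l⟩

lemma image_gridCube {d k : ℕ} (o : Fin d → ℤˣ) (γ : SignedPerm d)
    {g : Fin d → Fin (2 ^ k)} {g' : Fin d → Fin (2 ^ (k + 1))}
    (h : gridCentre (k + 1) g' = toSubcube o (γ.act (gridCentre k g))) :
    (fun x => toSubcube o (γ.act x)) '' gridCube k g = gridCube (k + 1) g' := by
  have hd : ∀ x j, |toSubcube o (γ.act x) j - gridCentre (k + 1) g' j| =
      |x (γ.perm.symm j) - gridCentre k g (γ.perm.symm j)| / 2 := by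
    intro x j
    rw [h, ← Pi.sub_apply x, ← γ.abs_act, γ.act_sub]
    simp only [toSubcube, Pi.sub_apply]
    rw [← abs_two, ← abs_div, abs_two]
    congr 1
    ring
  have hk : (1 : ℝ) / 2 ^ (k + 1 + 1) = 1 / 2 ^ (k + 1) / 2 := by
    rw [pow_succ _ (k + 1)]; field_simp
  have hmem : ∀ x, toSubcube o (γ.act x) ∈ gridCube (k + 1) g' ↔ x ∈ gridCube k g := by
    intro x
    rw [mem_gridCube_iff, mem_gridCube_iff]
    simp only [hd, hk]
    constructor
    · intro H j
      have := H (γ.perm j)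
      rw [Equiv.symm_apply_apply] at this
      linarith
    · intro H j
      have := H (γ.perm.symm j)
      linarith
  ext y
  constructor
  · rintro ⟨x, hx, rfl⟩
    exact (hmem x).2 hx
  · intro hy
    refine ⟨fun j => ((γ.sign j : ℤ) : ℝ) * (2 * y (γ.perm j) - ((o (γ.perm j) : ℤ) : ℝ) / 2),
      ?_⟩
    have he : toSubcube o (γ.act (fun j => ((γ.sign j : ℤ) : ℝ) *
        (2 * y (γ.perm j) - ((o (γ.perm j) : ℤ) : ℝ) / 2))) = y := by
      funext l
      simp only [toSubcube, SignedPerm.act, Equiv.apply_symm_apply]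
      rcases units_cast_cases (γ.sign (γ.perm.symm l)) with h | h <;> rw [h] <;> ring
    refine ⟨(hmem _).1 ?_, he⟩
    rw [he]
    exact hy

/-! ### Vertices of the approximating curves -/

/-- The index, among `N` consecutive segments, of the segment on which the `r`-th segment is
mapped by the direction function. -/
def flipIndex (b : Bool) (N r : ℕ) : ℕ := if b then N - 1 - r else r

lemma flipIndex_lt {b : Bool} {N r : ℕ} (h : r < N) : flipIndex b N r < N := by
  unfold flipIndex; split <;> omega

lemma flipIndex_flipIndex {b : Bool} {N r : ℕ} (h : r < N) :
    flipIndex b N (flipIndex b N r) = r := by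
  unfold flipIndex; split <;> omega

lemma direction_image {d : ℕ} (D : TraversalData d) (q : Fin (2 ^ d)) {k r : ℕ}
    (hr : r < 2 ^ (k * d)) :
    D.direction q '' timeSegment d k r =
      timeSegment d k (flipIndex (D.reversed q) (2 ^ (k * d)) r) := by
  unfold TraversalData.direction flipIndex
  cases D.reversed q
  · simp
  · simp only [if_true, timeSegment]
    rw [Set.image_const_sub_Icc, Nat.sub_sub, Nat.cast_sub (by omega)]
    have h3 : (2 : ℝ) ^ (k * d) ≠ 0 := by positivity
    push_cast
    congr 1 <;> field_simp <;> ring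

lemma timeSegment_subset {d k r : ℕ} (hr : r < 2 ^ (k * d)) :
    timeSegment d k r ⊆ Icc 0 1 := by
  have h3 : (0 : ℝ) < 2 ^ (k * d) := by positivity
  apply Icc_subset_Icc
  · positivity
  · rw [div_le_one h3]
    exact_mod_cast hr

lemma timeSegment_succ {d : ℕ} (k q r : ℕ) :
    timeSegment d (k + 1) (q * 2 ^ (k * d) + r) =
      (fun t : ℝ => ((q : ℝ) + t) / 2 ^ d) '' timeSegment d k r := by
  have h : (fun t : ℝ => ((q : ℝ) + t) / 2 ^ d) =
      (fun t : ℝ => t / 2 ^ d) ∘ (fun t => (q : ℝ) + t) := rfl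
  have h1 : (fun t : ℝ => t / 2 ^ d) = fun t => t * (2 ^ d)⁻¹ := by
    funext t; rw [div_eq_mul_inv]
  rw [h, image_comp, timeSegment, timeSegment, image_const_add_Icc, h1,
    image_mul_right_Icc' _ _ (by positivity)]
  have h3 : (2 : ℝ) ^ (k * d) ≠ 0 := by positivity
  have h4 : (2 : ℝ) ^ d ≠ 0 := by positivity
  rw [show (k + 1) * d = k * d + d by ring, pow_add]
  push_cast
  congr 1 <;> field_simp
  ring

lemma IsSelfSimilar.isApproxVertex_succ {d : ℕ} {τ : ℝ → Fin d → ℝ} {D : TraversalData d}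
    (h : IsSelfSimilar τ D) (q : Fin (2 ^ d)) {k r : ℕ} (hr : r < 2 ^ (k * d))
    {p : Fin d → ℝ}
    (hp : IsApproxVertex τ k (flipIndex (D.reversed q) (2 ^ (k * d)) r) p) :
    IsApproxVertex τ (k + 1) (q * 2 ^ (k * d) + r)
      (toSubcube (D.subcube q) ((D.symmetry q).act p)) := by
  obtain ⟨g, hg, rfl⟩ := hp
  obtain ⟨g', hg'⟩ := exists_gridCentre_toSubcube (D.subcube q) (D.symmetry q) g
  refine ⟨g', ?_, hg'.symm⟩
  rw [← image_gridCube _ _ hg', ← hg, ← direction_image D q hr, timeSegment_succ,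
    image_image, image_image, image_image]
  exact image_congr fun t ht => h q t (timeSegment_subset hr ht)

lemma IsHilbertCurve.exists_isApproxVertex {d : ℕ} {τ : ℝ → Fin d → ℝ}
    (hτ : IsHilbertCurve τ) (k : ℕ) {i : ℕ} (hi : i < 2 ^ (k * d)) :
    ∃ p, IsApproxVertex τ k i p := by
  obtain ⟨-, him, D, hD⟩ := hτ
  induction k generalizing i with
  | zero =>
    have hi0 : i = 0 := by simpa using hi
    subst hi0
    refine ⟨_, fun _ => ⟨0, by simp⟩, ?_, rfl⟩
    have : timeSegment d 0 0 = Icc 0 1 := by simp [timeSegment]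
    rw [this, him]
    ext x
    simp only [unitCube, gridCube, mem_ofPred_eq]
    refine forall_congr' fun j => ?_
    norm_num
  | succ k ih =>
    rw [show (k + 1) * d = k * d + d by ring, pow_add] at hi
    have hq : i / 2 ^ (k * d) < 2 ^ d := Nat.div_lt_of_lt_mul hi
    have hr : i % 2 ^ (k * d) < 2 ^ (k * d) := Nat.mod_lt _ (by positivity)
    obtain ⟨p, hp⟩ := ih (flipIndex_lt (b := D.reversed ⟨_, hq⟩) hr)
    have := hD.isApproxVertex_succ ⟨_, hq⟩ hr hp
    rw [Nat.div_add_mod'] at this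
    exact ⟨_, this⟩

open Classical in
/-- The `i`-th vertex of the `k`-th-order approximating curve. -/
noncomputable def vertex {d : ℕ} (τ : ℝ → Fin d → ℝ) (k i : ℕ) : Fin d → ℝ :=
  if h : ∃ p, IsApproxVertex τ k i p then h.choose else 0

lemma IsHilbertCurve.vertex_spec {d : ℕ} {τ : ℝ → Fin d → ℝ}
    (hτ : IsHilbertCurve τ) (k : ℕ) {i : ℕ} (hi : i < 2 ^ (k * d)) :
    IsApproxVertex τ k i (vertex τ k i) := by
  have h := hτ.exists_isApproxVertex k hi
  rw [vertex, dif_pos h]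
  exact h.choose_spec

lemma IsHilbertCurve.vertex_succ {d : ℕ} {τ : ℝ → Fin d → ℝ} (hτ : IsHilbertCurve τ)
    {D : TraversalData d} (hD : IsSelfSimilar τ D) (q : Fin (2 ^ d)) {k r : ℕ}
    (hr : r < 2 ^ (k * d)) :
    vertex τ (k + 1) (q * 2 ^ (k * d) + r) =
      toSubcube (D.subcube q) ((D.symmetry q).act
        (vertex τ k (flipIndex (D.reversed q) (2 ^ (k * d)) r))) := by
  refine (hτ.vertex_spec (k + 1) ?_).unique
    (hD.isApproxVertex_succ q hr (hτ.vertex_spec k (flipIndex_lt hr)))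
  rw [show (k + 1) * d = k * d + d by ring, pow_add]
  calc (q : ℕ) * 2 ^ (k * d) + r < (q : ℕ) * 2 ^ (k * d) + 2 ^ (k * d) := by omega
    _ = (q + 1) * 2 ^ (k * d) := by ring
    _ ≤ 2 ^ d * 2 ^ (k * d) := Nat.mul_le_mul_right _ q.2
    _ = _ := by ring

lemma IsHilbertCurve.abs_vertex_le {d : ℕ} {τ : ℝ → Fin d → ℝ} (hτ : IsHilbertCurve τ)
    (k : ℕ) {i : ℕ} (hi : i < 2 ^ (k * d)) (j : Fin d) :
    |vertex τ k i j| ≤ 1 / 2 - 1 / 2 ^ (k + 1) := by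
  obtain ⟨g, -, h⟩ := hτ.vertex_spec k hi
  rw [h]
  exact abs_gridCentre_le g j

lemma toSubcube_act_inj {d : ℕ} {o o' : Fin d → ℤˣ} {x y : Fin d → ℝ}
    (hx : ∀ j, |x j| < 1 / 2) (hy : ∀ j, |y j| < 1 / 2)
    (h : toSubcube o x = toSubcube o' y) : o = o' ∧ x = y := by
  have ho : o = o' := by
    funext j
    have hj := congrFun h j
    simp only [toSubcube] at hj
    have h1 := abs_lt.1 (hx j)
    have h2 := abs_lt.1 (hy j)
    rcases Int.units_eq_one_or (o j) with a | a <;> rcases Int.units_eq_one_or (o' j) with b | b <;>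
      rw [a, b] at hj ⊢ <;> push_cast at hj <;> linarith
  refine ⟨ho, funext fun j => ?_⟩
  have hj := congrFun h j
  subst ho
  simp only [toSubcube] at hj
  linarith

/-- Distinctness comes from the bijectivity of the octant order, by induction on the level; `τ`
itself need not be injective. -/
lemma IsHilbertCurve.vertex_injOn {d : ℕ} {τ : ℝ → Fin d → ℝ} (hτ : IsHilbertCurve τ)
    (k : ℕ) : InjOn (vertex τ k) (Iio (2 ^ (k * d))) := by
  obtain ⟨D, hD⟩ := hτ.2.2
  induction k with
  | zero =>
    intro i hi i' hi' _
    simp only [zero_mul, pow_zero, mem_Iio, Nat.lt_one_iff] at hi hi'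
    rw [hi, hi']
  | succ k ih =>
    intro i hi i' hi' h
    rw [mem_Iio, show (k + 1) * d = k * d + d by ring, pow_add] at hi hi'
    have hq : i / 2 ^ (k * d) < 2 ^ d := Nat.div_lt_of_lt_mul hi
    have hr : i % 2 ^ (k * d) < 2 ^ (k * d) := Nat.mod_lt _ (by positivity)
    have hq' : i' / 2 ^ (k * d) < 2 ^ d := Nat.div_lt_of_lt_mul hi'
    have hr' : i' % 2 ^ (k * d) < 2 ^ (k * d) := Nat.mod_lt _ (by positivity)
    have e := hτ.vertex_succ hD ⟨_, hq⟩ hr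
    have e' := hτ.vertex_succ hD ⟨_, hq'⟩ hr'
    simp only [Nat.div_add_mod'] at e e'
    rw [e, e'] at h
    have hlt : ∀ (γ : SignedPerm d) {i : ℕ} (_ : i < 2 ^ (k * d)) (j : Fin d),
        |γ.act (vertex τ k i) j| < 1 / 2 := by
      intro γ i hi j
      rw [γ.abs_act]
      have := hτ.abs_vertex_le k hi (γ.perm.symm j)
      have h2 : (0 : ℝ) < 1 / 2 ^ (k + 1) := by positivity
      linarith
    obtain ⟨h1, h2⟩ := toSubcube_act_inj (hlt _ (flipIndex_lt hr)) (hlt _ (flipIndex_lt hr')) h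
    have h3 := D.subcube.injective h1
    rw [h3] at h2
    have h4 := ih (flipIndex_lt hr) (flipIndex_lt hr') ((D.symmetry _).act_injective h2)
    have h5 : i % 2 ^ (k * d) = i' % 2 ^ (k * d) := by
      rw [← flipIndex_flipIndex (b := D.reversed ⟨_, hq'⟩) hr, h4, flipIndex_flipIndex hr']
    rw [← Nat.div_add_mod' i (2 ^ (k * d)), ← Nat.div_add_mod' i' (2 ^ (k * d)), h5,
      Fin.mk.inj_iff.1 h3]

/-! ### Face-continuity and adjacency of grid cubes -/

lemma gridCentre_mem_interior {d k : ℕ} (g : Fin d → Fin (2 ^ k)) :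
    gridCentre k g ∈ interior (gridCube k g) := by
  rw [mem_interior_iff_mem_nhds, Metric.mem_nhds_iff]
  refine ⟨1 / 2 ^ (k + 1), by positivity, fun y hy => ?_⟩
  rw [Metric.mem_ball, dist_pi_lt_iff (by positivity)] at hy
  rw [mem_gridCube_iff]
  exact fun j => (hy j).le

/-- Connectedness yields an interior point of the union on the hyperplane through the upper `j`-face
of the first cube. A small ball around it has its upper half in the second cube and its lower half
in the first, which leaves only a common facet. -/
lemma gridCube_adjacent_of_lt {d k : ℕ} {g g' : Fin d → Fin (2 ^ k)} {j : Fin d}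
    (hj : g j < g' j) (hc : IsConnected (interior (gridCube k g ∪ gridCube k g'))) :
    (g' j : ℕ) = g j + 1 ∧ ∀ l, l ≠ j → g' l = g l := by
  have hw : (0 : ℝ) < 2 ^ k := by positivity
  have hlow : ∀ {a b : ℕ}, a + 1 ≤ b → ((a : ℝ) + 1) / 2 ^ k ≤ (b : ℝ) / 2 ^ k := by
    intro a b hab
    rw [div_le_div_iff_of_pos_right hw]
    exact_mod_cast hab
  have hhalf : ∀ a : ℝ, (a + 1 / 2) / 2 ^ k = a / 2 ^ k + 1 / 2 ^ k / 2 ∧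
      (a + 1) / 2 ^ k = a / 2 ^ k + 1 / 2 ^ k := by
    intro a
    constructor <;> ring
  have hpos : (0 : ℝ) < 1 / 2 ^ k := by positivity
  set c : ℝ := -(1 / 2) + (((g j : ℕ) : ℝ) + 1) / 2 ^ k with hcdef
  have hgg := hlow (Nat.succ_le_of_lt (Fin.lt_def.1 hj))
  obtain ⟨x, hxS, hxj⟩ : c ∈ (fun x : Fin d → ℝ => x j) ''
      interior (gridCube k g ∪ gridCube k g') := by
    refine hc.isPreconnected.intermediate_value
      (interior_mono subset_union_left (gridCentre_mem_interior g))
      (interior_mono subset_union_right (gridCentre_mem_interior g'))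
      (continuous_apply j).continuousOn ⟨?_, ?_⟩
    · simp only [gridCentre, hcdef]
      have := hhalf (g j : ℕ)
      linarith
    · simp only [gridCentre, hcdef]
      have := hhalf (g' j : ℕ)
      linarith
  simp only at hxj
  rw [mem_interior_iff_mem_nhds, Metric.mem_nhds_iff] at hxS
  obtain ⟨ε₀, hε₀, hball⟩ := hxS
  obtain ⟨ε, hε, hεε₀, hεw⟩ : ∃ ε : ℝ, 0 < ε ∧ ε < ε₀ ∧ ε < 1 / 2 ^ k := by
    refine ⟨min ε₀ (1 / 2 ^ k) / 2, ?_, ?_, ?_⟩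
    · positivity
    · have := min_le_left ε₀ (1 / 2 ^ k)
      have : 0 < min ε₀ (1 / 2 ^ k : ℝ) := by positivity
      linarith
    · have := min_le_right ε₀ (1 / 2 ^ k)
      have : 0 < min ε₀ (1 / 2 ^ k : ℝ) := by positivity
      linarith
  have hnear : ∀ s : Fin d → ℝ, (∀ l, |s l| ≤ ε) →
      (fun l => x l + s l) ∈ gridCube k g ∪ gridCube k g' := by
    intro s hs
    apply hball
    rw [Metric.mem_ball, dist_pi_lt_iff hε₀]
    intro l
    rw [Real.dist_eq, add_sub_cancel_left]
    exact (hs l).trans_lt hεε₀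
  have hup : ∀ s : Fin d → ℝ, (∀ l, |s l| ≤ ε) → 0 < s j →
      (fun l => x l + s l) ∈ gridCube k g' := by
    intro s hs hsj
    refine (hnear s hs).resolve_left fun h => ?_
    have := (h j).2
    simp only at this
    linarith
  have hdown : ∀ s : Fin d → ℝ, (∀ l, |s l| ≤ ε) → s j < 0 →
      (fun l => x l + s l) ∈ gridCube k g := by
    intro s hs hsj
    refine (hnear s hs).resolve_right fun h => ?_
    have := (h j).1
    simp only at this
    linarith
  have hε' : |ε| ≤ ε := (abs_of_pos hε).le
  have hε'' : |-ε| ≤ ε := by rw [abs_neg]; exact hε'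
  constructor
  · by_contra hne
    have h2 : (g j : ℕ) + 1 + 1 ≤ (g' j : ℕ) := by
      have := Fin.lt_def.1 hj
      omega
    have h3 := hlow h2
    have h4 := (hup (fun _ => ε) (fun _ => hε') hε j).1
    simp only at h4
    have := hhalf (g j : ℕ)
    have h5 := (hhalf ((g j : ℕ) + 1)).2
    push_cast at h3
    linarith
  · intro l hl
    -- Shifts by `ε` and `-ε` along axis `l`, on both sides of the hyperplane, show that the
    -- `l`-ranges of the two cubes overlap in positive length; grid intervals that do so coincide.
    have hs : ∀ a b : ℝ, |a| ≤ ε → |b| ≤ ε → ∀ m : Fin d, |if m = j then a else b| ≤ ε := by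
      intro a b ha hb m
      split_ifs
      exacts [ha, hb]
    have u1 := (hup _ (hs ε ε hε' hε') (by simpa using hε) l).2
    have u2 := (hup _ (hs ε (-ε) hε' hε'') (by simpa using hε) l).1
    have d1 := (hdown _ (hs (-ε) ε hε'' hε') (by simpa using hε) l).2
    have d2 := (hdown _ (hs (-ε) (-ε) hε'' hε'') (by simpa using hε) l).1
    simp only [if_neg hl] at u1 u2 d1 d2
    rcases lt_trichotomy (g' l) (g l) with h | h | h
    · have := hlow (Nat.succ_le_of_lt (Fin.lt_def.1 h))
      linarith
    · exact h
    · have := hlow (Nat.succ_le_of_lt (Fin.lt_def.1 h))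
      linarith

lemma gridCube_adjacent {d k : ℕ} {g g' : Fin d → Fin (2 ^ k)} (hne : g ≠ g')
    (hc : IsConnected (interior (gridCube k g ∪ gridCube k g'))) :
    ∃ j, |gridCentre k g' j - gridCentre k g j| = 1 / 2 ^ k ∧
      ∀ l, l ≠ j → gridCentre k g' l = gridCentre k g l := by
  have hpos : (0 : ℝ) < 1 / 2 ^ k := by positivity
  obtain ⟨j, hj⟩ := Function.ne_iff.1 hne
  refine ⟨j, ?_⟩
  rcases lt_or_gt_of_ne hj with h | h
  · obtain ⟨h1, h2⟩ := gridCube_adjacent_of_lt h hc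
    refine ⟨?_, fun l hl => by simp only [gridCentre, h2 l hl]⟩
    simp only [gridCentre, h1]
    push_cast
    rw [← abs_of_pos hpos]
    congr 1
    ring
  · rw [union_comm] at hc
    obtain ⟨h1, h2⟩ := gridCube_adjacent_of_lt h hc
    refine ⟨?_, fun l hl => by simp only [gridCentre, h2 l hl]⟩
    simp only [gridCentre, h1]
    push_cast
    rw [← abs_of_pos hpos, abs_sub_comm]
    congr 1
    ring

lemma timeSegment_union {d : ℕ} (k i : ℕ) :
    timeSegment d k i ∪ timeSegment d k (i + 1) =
      Icc ((i : ℝ) / 2 ^ (k * d)) (((i : ℝ) + 2) / 2 ^ (k * d)) := by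
  unfold timeSegment
  push_cast
  rw [Icc_union_Icc_eq_Icc]
  · congr 1; ring
  · gcongr; linarith
  · gcongr; linarith

/-- Two successive time segments form one section of the curve, so face-continuity applies to the
union of their two cubes. -/
lemma vertex_adjacent {d : ℕ} {τ : ℝ → Fin d → ℝ} (hτ : IsHilbertCurve τ)
    (hface : IsFaceContinuous τ) (k : ℕ) {i : ℕ} (hi : i + 1 < 2 ^ (k * d)) :
    ∃ j, |vertex τ k (i + 1) j - vertex τ k i j| = 1 / 2 ^ k ∧
      ∀ l, l ≠ j → vertex τ k (i + 1) l = vertex τ k i l := by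
  have hi0 : i < 2 ^ (k * d) := by omega
  have hne : vertex τ k i ≠ vertex τ k (i + 1) := fun h => by
    have := hτ.vertex_injOn k hi0 hi h
    omega
  obtain ⟨g, hg, h⟩ := hτ.vertex_spec k hi0
  obtain ⟨g', hg', h'⟩ := hτ.vertex_spec k hi
  rw [h, h'] at hne ⊢
  refine gridCube_adjacent (fun h => hne (by rw [h])) ?_
  rw [← hg, ← hg', ← image_union, timeSegment_union]
  have h3 : (0 : ℝ) < 2 ^ (k * d) := by positivity
  refine hface _ _ (by positivity) (by gcongr; linarith) ?_
  rw [div_le_one h3]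
  exact_mod_cast hi

/-! ### Sign combinatorics of the gates -/

lemma units_neg_ne (s : ℤˣ) : -s ≠ s := by
  rcases Int.units_eq_one_or s with h | h <;> rw [h] <;> decide

lemma eq_of_ne_ne {u v x y : Fin 3} (h : u ≠ v) (hxu : x ≠ u) (hxv : x ≠ v) (hyu : y ≠ u)
    (hyv : y ≠ v) : x = y := by
  revert u v x y
  decide

/-- Sign data of the second-level refinement of a face-continuous traversal of the cube. `o q`
gives the position of the `q`-th octant, `r q` and `r' q` compare with it the positions of the
first and the last suboctant of that octant (`1` means outside, `-1` means next to the centre),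
and `j q` is the direction of the step from the `q`-th octant to the next. -/
structure GateSigns (o : Fin 8 → Fin 3 → ℤˣ) (π : Fin 8 → Equiv.Perm (Fin 3))
    (r r' : Fin 8 → Fin 3 → ℤˣ) (j : Fin 7 → Fin 3) : Prop where
  injective : Function.Injective o
  surjective : Function.Surjective o
  step : ∀ q l, o q.succ l = if l = j q then -o q.castSucc l else o q.castSucc l
  entry : ∀ (q : Fin 7), r q.succ = r' q.castSucc
  exit : ∀ q l, r' q l = (o 0 ((π q).symm l) * o 7 ((π q).symm l)) * r q l
  inner : ∀ q : Fin 7, r' q.castSucc (j q) = -1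
  outer : ∀ q : Fin 7, r 0 ((π q.castSucc).symm (j q)) = 1 ∨
    r' 7 ((π q.castSucc).symm (j q)) = 1

namespace GateSigns

variable {o : Fin 8 → Fin 3 → ℤˣ} {π : Fin 8 → Equiv.Perm (Fin 3)}
  {r r' : Fin 8 → Fin 3 → ℤˣ} {j : Fin 7 → Fin 3}

lemma exists_step (h : GateSigns o π r r' j) (l : Fin 3) : ∃ q, j q = l := by
  by_contra! hne
  have hconst : ∀ q, o q l = o 0 l := by
    intro q
    induction q using Fin.induction with
    | zero => rfl
    | succ q ih => rw [h.step, if_neg (hne q).symm, ih]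
  obtain ⟨q, hq⟩ := h.surjective (fun _ => -o 0 l)
  have := hconst q
  rw [hq] at this
  exact units_neg_ne _ this

/-- Parity: each of the seven steps flips exactly one sign. -/
lemma prod_eq (h : GateSigns o π r r' j) :
    (o 0 0 * o 7 0) * (o 0 1 * o 7 1) * (o 0 2 * o 7 2) = -1 := by
  have hs : ∀ q : Fin 7, o q.succ 0 * o q.succ 1 * o q.succ 2 =
      -(o q.castSucc 0 * o q.castSucc 1 * o q.castSucc 2) := by
    intro q
    rw [h.step, h.step, h.step]
    generalize j q = a
    fin_cases a <;> simp
  have h7 : o 7 0 * o 7 1 * o 7 2 = -(o 0 0 * o 0 1 * o 0 2) := by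
    have h0 := hs 0
    have h1 := hs 1
    have h2 := hs 2
    have h3 := hs 3
    have h4 := hs 4
    have h5 := hs 5
    have h6 := hs 6
    simp only [Fin.reduceSucc, Fin.reduceCastSucc] at h0 h1 h2 h3 h4 h5 h6
    rw [h6, h5, h4, h3, h2, h1, h0]
    simp
  calc _ = (o 0 0 * o 0 1 * o 0 2) * (o 7 0 * o 7 1 * o 7 2) := by
        simp only [mul_comm, mul_left_comm, mul_assoc]
    _ = -1 := by rw [h7, mul_neg, Int.units_mul_self]

/-- If an axis is never changed between the ends of an octant, then all gates are inside. -/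
lemma eq_neg_one (h : GateSigns o π r r' j) {l : Fin 3} (hr : ∀ q, r' q l = r q l) (q : Fin 8) :
    r q l = -1 := by
  have hc : ∀ q, r q l = r 0 l := by
    intro q
    induction q using Fin.induction with
    | zero => rfl
    | succ q ih => rw [h.entry, hr, ih]
  obtain ⟨q', rfl⟩ := h.exists_step l
  rw [hc, ← hc q'.castSucc, ← hr, h.inner]

/-- If every axis changed inside every octant, `r q` would alternate between `r 0` and `-r 0`, so
the even and the odd steps would use disjoint sets of axes. Either way axis `j 0` is then flipped an
even number of times in total. -/
lemma not_all_neg (h : GateSigns o π r r' j) : ¬ ∀ l, o 0 l * o 7 l = -1 := by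
  intro hs
  have hr : ∀ q l, r' q l = -r q l := by
    intro q l
    rw [h.exit, hs, neg_one_mul]
  have hsucc : ∀ q : Fin 7, r q.succ = -r q.castSucc := by
    intro q
    rw [h.entry]
    exact funext (hr _)
  have hin : ∀ q : Fin 7, r q.castSucc (j q) = 1 := by
    intro q
    have := hr q.castSucc (j q)
    rw [h.inner] at this
    exact (neg_injective this).symm
  have r1 := hsucc 0
  have r2 := hsucc 1
  have r3 := hsucc 2
  have r4 := hsucc 3
  have r5 := hsucc 4
  have r6 := hsucc 5
  have i0 := hin 0
  have i1 := hin 1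
  have i2 := hin 2
  have i3 := hin 3
  have i4 := hin 4
  have i5 := hin 5
  have i6 := hin 6
  have s0 := h.step 0
  have s1 := h.step 1
  have s2 := h.step 2
  have s3 := h.step 3
  have s4 := h.step 4
  have s5 := h.step 5
  have s6 := h.step 6
  simp only [Fin.reduceSucc, Fin.reduceCastSucc] at r1 r2 r3 r4 r5 r6 i0 i1 i2 i3 i4 i5 i6
  simp only [Fin.reduceSucc, Fin.reduceCastSucc] at s0 s1 s2 s3 s4 s5 s6
  rw [r1] at i1
  rw [r2, r1, neg_neg] at i2
  rw [r3, r2, r1, neg_neg] at i3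
  rw [r4, r3, r2, r1, neg_neg, neg_neg] at i4
  rw [r5, r4, r3, r2, r1, neg_neg, neg_neg] at i5
  rw [r6, r5, r4, r3, r2, r1, neg_neg, neg_neg, neg_neg] at i6
  simp only [Pi.neg_apply] at i1 i3 i5
  have hne : ∀ {u v}, r 0 u = 1 → -r 0 v = 1 → u ≠ v := by
    rintro u v h1 h2 rfl
    rw [h1] at h2
    exact absurd h2 (by decide)
  have hodd : ∀ l, o 7 l ≠ o 0 l := by
    intro l hl
    have := hs l
    rw [hl, Int.units_mul_self] at this
    exact absurd this (by decide)
  -- If the odd steps share one axis, two equal successive even steps would close a 4-cycle of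
  -- octants. The even steps thus alternate between the other two axes, and `j 0` is flipped only at
  -- steps 0 and 4.
  by_cases hj : j 1 = j 3 ∧ j 3 = j 5
  · have e02 : j 0 ≠ j 2 := by
      intro he
      have : o 4 = o 0 := by
        funext l
        rw [s3, s2, s1, s0, ← he, hj.1]
        split_ifs <;> simp
      exact absurd (h.injective this) (by decide)
    have e24 : j 2 ≠ j 4 := by
      intro he
      have : o 5 = o 1 := by
        funext l
        rw [s4, s3, s2, s1, ← he, hj.1]
        split_ifs <;> simp
      exact absurd (h.injective this) (by decide)
    have e46 : j 4 ≠ j 6 := by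
      intro he
      have : o 7 = o 3 := by
        funext l
        rw [s6, s5, s4, s3, ← he, hj.2]
        split_ifs <;> simp
      exact absurd (h.injective this) (by decide)
    have e04 : j 0 = j 4 := eq_of_ne_ne (hne i2 i1) e02 (hne i0 i1) e24.symm (hne i4 i1)
    refine hodd (j 0) ?_
    rw [s6, s5, s4, s3, s2, s1, s0, if_pos rfl, if_neg (hne i0 i1), if_neg e02,
      if_neg (hne i0 i3), if_pos e04, if_neg (hne i0 i5), if_neg (e04 ▸ e46), neg_neg]
  -- Two distinct odd axes leave a single axis for all four even steps.
  · obtain ⟨u, v, huv, hu, hv⟩ : ∃ u v, u ≠ v ∧ -r 0 u = 1 ∧ -r 0 v = 1 := by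
      by_cases h13 : j 1 = j 3
      · exact ⟨_, _, fun h35 => hj ⟨h13, h35⟩, i3, i5⟩
      · exact ⟨_, _, h13, i1, i3⟩
    have hall : ∀ x y, r 0 x = 1 → r 0 y = 1 → x = y := fun x y hx hy =>
      eq_of_ne_ne huv (hne hx hu) (hne hx hv) (hne hy hu) (hne hy hv)
    refine hodd (j 0) ?_
    rw [s6, s5, s4, s3, s2, s1, s0, if_pos rfl, if_neg (hne i0 i1), if_pos (hall _ _ i0 i2),
      if_neg (hne i0 i3), if_pos (hall _ _ i0 i4), if_neg (hne i0 i5),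
      if_pos (hall _ _ i0 i6)]
    simp

lemma exists_unique_neg (h : GateSigns o π r r' j) :
    ∃ m, o 0 m * o 7 m = -1 ∧ ∀ l, l ≠ m → o 0 l * o 7 l = 1 := by
  have hp := h.prod_eq
  have hn := h.not_all_neg
  generalize hσ : (fun l => o 0 l * o 7 l) = σ at *
  have hσ' : ∀ l, o 0 l * o 7 l = σ l := fun l => congrFun hσ l
  simp only [hσ'] at hp hn ⊢
  revert hp hn
  clear * -
  rcases Int.units_eq_one_or (σ 0) with a | a <;> rcases Int.units_eq_one_or (σ 1) with b | b <;>
    rcases Int.units_eq_one_or (σ 2) with c | c <;>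
    simp [Fin.forall_fin_succ, Fin.exists_fin_succ, a, b, c]

/-- If the axis changes of all octants agree, then all steps go along the image of one axis. -/
lemma exists_axis (h : GateSigns o π r r' j) {s : Fin 3 → ℤˣ}
    (hs : ∀ q l, o 0 ((π q).symm l) * o 7 ((π q).symm l) = s l) :
    ∃ m, s m = -1 ∧ ∀ q : Fin 7, j q = π q.castSucc m := by
  obtain ⟨m, hm, hm'⟩ := h.exists_unique_neg
  refine ⟨π 0 m, by rw [← hs 0, Equiv.symm_apply_apply, hm], fun q => ?_⟩
  rw [← Equiv.symm_apply_eq]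
  by_contra hne
  -- A pulled-back step axis `n` other than the claimed one keeps its sign in every octant, so all
  -- gates are inside along `n`, contrary to `outer`.
  set n := (π q.castSucc).symm (j q) with hn
  have hsn : s n = 1 := by
    rw [← hs 0]
    apply hm'
    rwa [Ne, Equiv.symm_apply_eq]
  have hr : ∀ q, r' q n = r q n := fun q => by rw [h.exit, hs, hsn, one_mul]
  have := h.outer q
  rw [← hn, hr, h.eq_neg_one hr, h.eq_neg_one hr] at this
  revert this
  decide

/-- If the fixed axis is the one in which the first and last octants differ, `exists_axis` puts all
steps along it. Otherwise its gates are all inside, and `outer` fails at a step along it. -/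
theorem not_fixed (h : GateSigns o π r r' j) (a : Fin 3) : ¬ ∀ q, π q a = a := by
  intro ha
  have ha' : ∀ q, (π q).symm a = a := fun q => by rw [Equiv.symm_apply_eq, ha]
  obtain ⟨m, hm, hm'⟩ := h.exists_unique_neg
  by_cases h1 : a = m
  · subst h1
    have hs : ∀ q l, o 0 ((π q).symm l) * o 7 ((π q).symm l) = if l = a then -1 else 1 := by
      intro q l
      split_ifs with hl
      · rw [hl, ha', hm]
      · apply hm'
        rwa [Ne, Equiv.symm_apply_eq, ha]
    obtain ⟨m', hma, hj⟩ := h.exists_axis hs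
    have : m' = a := by
      by_contra hne
      rw [if_neg hne] at hma
      exact absurd hma (by decide)
    subst this
    obtain ⟨q, hq⟩ := h.exists_step (m' + 1)
    rw [hj, ha] at hq
    revert hq
    clear * -
    revert m'
    decide
  · have hr : ∀ q, r' q a = r q a := fun q => by rw [h.exit, ha', hm' a h1, one_mul]
    obtain ⟨q, hq⟩ := h.exists_step a
    have := h.outer q
    rw [hq, ha', hr, h.eq_neg_one hr, h.eq_neg_one hr] at this
    revert this
    decide

theorem not_const (h : GateSigns o π r r' j) (p : Equiv.Perm (Fin 3)) : ¬ ∀ q, π q = p := by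
  intro hp
  obtain ⟨m, -, hj⟩ := h.exists_axis (s := fun l => o 0 (p.symm l) * o 7 (p.symm l))
    (fun q l => by rw [hp])
  obtain ⟨q, hq⟩ := h.exists_step (p m + 1)
  rw [hj, hp] at hq
  revert hq
  generalize p m = x
  revert x
  decide

end GateSigns
-- Gates of a face-continuous Hilbert curve
variable {τ : ℝ → Fin 3 → ℝ} {D : TraversalData 3}

/-- The position, relative to its octant, of the first `k`-th-level subcube that is visited in the
`q`-th octant. -/
noncomputable def entryGate (τ : ℝ → Fin 3 → ℝ) (D : TraversalData 3) (k : ℕ) (q : Fin 8) :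
    Fin 3 → ℝ :=
  (D.symmetry q).act (vertex τ k (flipIndex (D.reversed q) (2 ^ (k * 3)) 0))

/-- The position, relative to its octant, of the last `k`-th-level subcube that is visited in the
`q`-th octant. -/
noncomputable def exitGate (τ : ℝ → Fin 3 → ℝ) (D : TraversalData 3) (k : ℕ) (q : Fin 8) :
    Fin 3 → ℝ :=
  (D.symmetry q).act (vertex τ k (flipIndex (D.reversed q) (2 ^ (k * 3)) (2 ^ (k * 3) - 1)))

lemma vertex_first (hτ : IsHilbertCurve τ) (hD : IsSelfSimilar τ D) (k : ℕ) (q : Fin 8) :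
    vertex τ (k + 1) ((q : ℕ) * 2 ^ (k * 3)) = toSubcube (D.subcube q) (entryGate τ D k q) :=
  hτ.vertex_succ hD q (r := 0) (by positivity)

lemma vertex_last (hτ : IsHilbertCurve τ) (hD : IsSelfSimilar τ D) (k : ℕ) (q : Fin 8) :
    vertex τ (k + 1) ((q : ℕ) * 2 ^ (k * 3) + (2 ^ (k * 3) - 1)) =
      toSubcube (D.subcube q) (exitGate τ D k q) :=
  hτ.vertex_succ hD q (Nat.sub_lt (by positivity) one_pos)

lemma abs_entryGate_le (hτ : IsHilbertCurve τ) (k : ℕ) (q : Fin 8) (l : Fin 3) :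
    |entryGate τ D k q l| ≤ 1 / 2 - 1 / 2 ^ (k + 1) := by
  rw [entryGate, SignedPerm.abs_act]
  exact hτ.abs_vertex_le k (flipIndex_lt (by positivity)) _

lemma abs_exitGate_le (hτ : IsHilbertCurve τ) (k : ℕ) (q : Fin 8) (l : Fin 3) :
    |exitGate τ D k q l| ≤ 1 / 2 - 1 / 2 ^ (k + 1) := by
  rw [exitGate, SignedPerm.abs_act]
  exact hτ.abs_vertex_le k (flipIndex_lt (Nat.sub_lt (by positivity) one_pos)) _

lemma gate_adjacent (hτ : IsHilbertCurve τ) (hD : IsSelfSimilar τ D)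
    (hface : IsFaceContinuous τ) (k : ℕ) (q : Fin 7) :
    ∃ j, |toSubcube (D.subcube q.succ) (entryGate τ D k q.succ) j -
        toSubcube (D.subcube q.castSucc) (exitGate τ D k q.castSucc) j| = 1 / 2 ^ (k + 1) ∧
      ∀ l, l ≠ j → toSubcube (D.subcube q.succ) (entryGate τ D k q.succ) l =
        toSubcube (D.subcube q.castSucc) (exitGate τ D k q.castSucc) l := by
  rw [← vertex_first hτ hD, ← vertex_last hτ hD]
  have hN : 0 < 2 ^ (k * 3) := by positivity
  have e : ((q.succ : Fin 8) : ℕ) * 2 ^ (k * 3) =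
      ((q.castSucc : Fin 8) : ℕ) * 2 ^ (k * 3) + (2 ^ (k * 3) - 1) + 1 := by
    rw [Fin.val_succ, Fin.val_castSucc, add_mul]
    omega
  rw [e]
  apply vertex_adjacent hτ hface
  rw [← e, Fin.val_succ, show (k + 1) * 3 = k * 3 + 3 by ring, pow_add, mul_comm]
  have := q.2
  gcongr
  omega

lemma exists_step_axis (hτ : IsHilbertCurve τ) (hD : IsSelfSimilar τ D)
    (hface : IsFaceContinuous τ) (q : Fin 7) :
    ∃ j, ∀ l, D.subcube q.succ l =
      if l = j then -D.subcube q.castSucc l else D.subcube q.castSucc l := by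
  obtain ⟨j, hj, hl⟩ := gate_adjacent hτ hD hface 0 q
  have h1 : ∀ l, entryGate τ D 0 q.succ l = 0 := fun l => by
    have := abs_entryGate_le (D := D) hτ 0 q.succ l
    norm_num at this
    exact this
  have h2 : ∀ l, exitGate τ D 0 q.castSucc l = 0 := fun l => by
    have := abs_exitGate_le (D := D) hτ 0 q.castSucc l
    norm_num at this
    exact this
  refine ⟨j, fun l => ?_⟩
  split_ifs with h
  · subst h
    simp only [toSubcube, h1, h2] at hj
    rcases Int.units_eq_one_or (D.subcube q.succ l) with a | a <;>
      rcases Int.units_eq_one_or (D.subcube q.castSucc l) with b | b <;>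
      rw [a, b] at hj ⊢ <;> first | rfl | norm_num at hj
  · have := hl l h
    simp only [toSubcube, h1, h2] at this
    rcases Int.units_eq_one_or (D.subcube q.succ l) with a | a <;>
      rcases Int.units_eq_one_or (D.subcube q.castSucc l) with b | b <;>
      rw [a, b] at this ⊢ <;> norm_num at this

/-- The two gates lie strictly inside octants on opposite sides of a hyperplane, so the connecting
edge must cross it; having only one grid width to do so, both gates touch the shared face. -/
lemma gate_eq (hτ : IsHilbertCurve τ) (hD : IsSelfSimilar τ D)
    (hface : IsFaceContinuous τ) (k : ℕ) (q : Fin 7) {j : Fin 3}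
    (hj : ∀ l, D.subcube q.succ l =
      if l = j then -D.subcube q.castSucc l else D.subcube q.castSucc l) :
    (exitGate τ D k q.castSucc j =
      -((D.subcube q.castSucc j : ℤ) : ℝ) * (1 / 2 - 1 / 2 ^ (k + 1))) ∧
    (entryGate τ D k q.succ j =
      -((D.subcube q.succ j : ℤ) : ℝ) * (1 / 2 - 1 / 2 ^ (k + 1))) ∧
    ∀ l, l ≠ j → exitGate τ D k q.castSucc l = entryGate τ D k q.succ l := by
  obtain ⟨j', hj', hl'⟩ := gate_adjacent hτ hD hface k q
  have h1 := abs_le.1 (abs_entryGate_le (D := D) hτ k q.succ j)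
  have h2 := abs_le.1 (abs_exitGate_le (D := D) hτ k q.castSucc j)
  have hpos : (0 : ℝ) < 1 / 2 ^ (k + 1) := by positivity
  have hjj := hj j
  rw [if_pos rfl] at hjj
  have hjj' : j' = j := by
    by_contra hne
    have := hl' j (Ne.symm hne)
    simp only [toSubcube, hjj] at this
    rcases Int.units_eq_one_or (D.subcube q.castSucc j) with b | b <;>
      rw [b] at this <;> push_cast at this <;> linarith
  subst hjj'
  refine ⟨?_, ?_, fun l hl => ?_⟩
  · simp only [toSubcube, hjj] at hj'
    rcases Int.units_eq_one_or (D.subcube q.castSucc j') with b | b <;>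
      rw [b] at hj' ⊢ <;> push_cast at hj' ⊢ <;>
      rcases abs_cases (_ : ℝ) with ⟨c, -⟩ | ⟨c, -⟩ <;> rw [c] at hj' <;> linarith
  · simp only [toSubcube, hjj] at hj' ⊢
    rcases Int.units_eq_one_or (D.subcube q.castSucc j') with b | b <;>
      rw [b] at hj' ⊢ <;> push_cast at hj' ⊢ <;>
      rcases abs_cases (_ : ℝ) with ⟨c, -⟩ | ⟨c, -⟩ <;> rw [c] at hj' <;> linarith
  · have h3 := hl' l hl
    have h4 := hj l
    rw [if_neg hl] at h4
    simp only [toSubcube, h4] at h3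
    linarith

/-- The side of the first suboctant of the `q`-th octant, relative to that octant. -/
def entrySign (D : TraversalData 3) (q : Fin 8) (l : Fin 3) : ℤˣ :=
  D.subcube q l * ((D.symmetry q).sign ((D.symmetry q).perm.symm l) *
    D.subcube (if D.reversed q then (7 : Fin 8) else (0 : Fin 8)) ((D.symmetry q).perm.symm l))

/-- The side of the last suboctant of the `q`-th octant, relative to that octant. -/
def exitSign (D : TraversalData 3) (q : Fin 8) (l : Fin 3) : ℤˣ :=
  D.subcube q l * ((D.symmetry q).sign ((D.symmetry q).perm.symm l) *
    D.subcube (if D.reversed q then (0 : Fin 8) else (7 : Fin 8)) ((D.symmetry q).perm.symm l))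

lemma vertex_one (hτ : IsHilbertCurve τ) (hD : IsSelfSimilar τ D) (q : Fin 8) (l : Fin 3) :
    vertex τ 1 q l = ((D.subcube q l : ℤ) : ℝ) / 4 := by
  have h := vertex_first hτ hD 0 q
  have h1 : entryGate τ D 0 q l = 0 := by
    have := abs_entryGate_le (D := D) hτ 0 q l
    norm_num at this
    exact this
  simp only [zero_mul, pow_zero, mul_one, zero_add] at h
  rw [h, toSubcube, h1]
  ring

lemma entryGate_one (hτ : IsHilbertCurve τ) (hD : IsSelfSimilar τ D) (q : Fin 8) (l : Fin 3) :
    entryGate τ D 1 q l =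
      ((D.subcube q l : ℤ) : ℝ) * ((entrySign D q l : ℤ) : ℝ) / 4 := by
  have h0 := vertex_one hτ hD 0
  have h7 := vertex_one hτ hD 7
  have hs := units_cast_cases (D.subcube q l)
  simp only [entryGate, entrySign, SignedPerm.act, flipIndex]
  cases D.reversed q
  · simp only [Bool.false_eq_true, if_false]
    erw [h0]
    push_cast
    rcases hs with h | h <;> rw [h] <;> ring
  · simp only [if_true]
    erw [h7]
    push_cast
    rcases hs with h | h <;> rw [h] <;> ring

lemma exitGate_one (hτ : IsHilbertCurve τ) (hD : IsSelfSimilar τ D) (q : Fin 8) (l : Fin 3) :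
    exitGate τ D 1 q l =
      ((D.subcube q l : ℤ) : ℝ) * ((exitSign D q l : ℤ) : ℝ) / 4 := by
  have h0 := vertex_one hτ hD 0
  have h7 := vertex_one hτ hD 7
  have hs := units_cast_cases (D.subcube q l)
  simp only [exitGate, exitSign, SignedPerm.act, flipIndex]
  cases D.reversed q
  · simp only [Bool.false_eq_true, if_false]
    erw [h7]
    push_cast
    rcases hs with h | h <;> rw [h] <;> ring
  · simp only [if_true]
    erw [h0]
    push_cast
    rcases hs with h | h <;> rw [h] <;> ring

lemma outer_of_abs {o r : ℤˣ}
    (h : |((o : ℤ) : ℝ) / 4 + ((o : ℤ) : ℝ) * ((r : ℤ) : ℝ) / 4 / 2| = 3 / 8) : r = 1 := by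
  rcases Int.units_eq_one_or o with a | a <;> rcases Int.units_eq_one_or r with b | b <;>
    rw [a, b] at h <;> norm_num [abs_of_pos, abs_of_neg] at h <;> exact b

lemma outer_of_first (hτ : IsHilbertCurve τ) (hD : IsSelfSimilar τ D) {l : Fin 3}
    (h : |vertex τ 2 0 l| = 3 / 8) : entrySign D 0 l = 1 := by
  have h2 := vertex_first hτ hD 1 0
  simp only [Fin.val_zero, zero_mul] at h2
  rw [h2, toSubcube, entryGate_one hτ hD] at h
  exact outer_of_abs h

lemma outer_of_last (hτ : IsHilbertCurve τ) (hD : IsSelfSimilar τ D) {l : Fin 3}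
    (h : |vertex τ 2 63 l| = 3 / 8) : exitSign D 7 l = 1 := by
  have h2 : vertex τ 2 63 = _ := vertex_last hτ hD 1 7
  rw [h2, toSubcube, exitGate_one hτ hD] at h
  exact outer_of_abs h

/-- Gates at level 1 give all the sign relations except `outer`, which needs level 2. -/
lemma exists_gateSigns (hτ : IsHilbertCurve τ) (hD : IsSelfSimilar τ D)
    (hface : IsFaceContinuous τ) :
    ∃ j, GateSigns (fun q => D.subcube q) (fun q => (D.symmetry q).perm)
      (entrySign D) (exitSign D) j := by
  choose j hj using exists_step_axis hτ hD hface
  have hg := fun k q => gate_eq hτ hD hface k q (hj q)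
  have hout : ∀ q, exitSign D q.castSucc (j q) = -1 := by
    intro q
    have h := (hg 1 q).1
    rw [exitGate_one hτ hD] at h
    rcases Int.units_eq_one_or (D.subcube q.castSucc (j q)) with a | a <;>
      rcases Int.units_eq_one_or (exitSign D q.castSucc (j q)) with b | b <;>
      rw [a, b] at h <;> norm_num at h <;> exact b
  have hin : ∀ q, entrySign D q.succ (j q) = -1 := by
    intro q
    have h := (hg 1 q).2.1
    rw [entryGate_one hτ hD] at h
    rcases Int.units_eq_one_or (D.subcube q.succ (j q)) with a | a <;>
      rcases Int.units_eq_one_or (entrySign D q.succ (j q)) with b | b <;>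
      rw [a, b] at h <;> norm_num at h <;> exact b
  refine ⟨j, D.subcube.injective, D.subcube.surjective, hj, fun q => funext fun l => ?_,
    fun q l => ?_, hout, fun q => ?_⟩
  · by_cases hl : l = j q
    · rw [hl, hin, hout]
    · have h := (hg 1 q).2.2 l hl
      have ho := hj q l
      rw [if_neg hl] at ho
      rw [exitGate_one hτ hD, entryGate_one hτ hD, ho] at h
      rcases Int.units_eq_one_or (D.subcube q.castSucc l) with a | a <;>
        rcases Int.units_eq_one_or (exitSign D q.castSucc l) with b | b <;>
        rcases Int.units_eq_one_or (entrySign D q.succ l) with c | c <;>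
        rw [a, b, c] at h <;> norm_num at h <;> rw [b, c]
  · have hu : ∀ a b c e : ℤˣ, a * (b * c) = e * c * (a * (b * e)) ∧
        a * (b * c) = c * e * (a * (b * e)) := by decide
    simp only [entrySign, exitSign]
    cases D.reversed q
    · exact (hu _ _ _ _).1
    · exact (hu _ _ _ _).2
  -- Symmetries preserve absolute values, so an end vertex of A_2 has a coordinate of modulus 1/2 -
  -- 1/8 = 3/8. The direction decides whether it is the first vertex or the last.
  · have h := congrArg abs (hg 2 q).1
    rw [abs_mul, abs_neg, abs_units_cast, exitGate, SignedPerm.abs_act] at h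
    norm_num [flipIndex] at h
    cases hr : D.reversed q.castSucc
    · right
      apply outer_of_last hτ hD
      rw [hr] at h
      simpa using h
    · left
      apply outer_of_first hτ hD
      rw [hr] at h
      simpa using h

/-! ### Contraction under averages of permutations -/

/-- All `π q` agree at `b` and at the common image of `b`. If these are two distinct points, they
determine a permutation of three points. -/
lemma perm_fixed_or_const {ι : Type*} [Nonempty ι] {π : ι → Equiv.Perm (Fin 3)} {a b : Fin 3}
    (h : ∀ p q, (π p).symm ((π q).symm a) = b) :
    (∃ c, ∀ q, π q c = c) ∨ ∃ p, ∀ q, π q = p := by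
  obtain ⟨q₀⟩ := ‹Nonempty ι›
  have h1 : ∀ p, π p b = π q₀ b := fun p => by
    rw [← (Equiv.symm_apply_eq (π p)).1 (h p q₀), ← (Equiv.symm_apply_eq (π q₀)).1 (h q₀ q₀)]
  have h2 : ∀ q, π q (π q₀ b) = a := fun q => by
    rw [← (Equiv.symm_apply_eq (π q₀)).1 (h q₀ q), Equiv.apply_symm_apply]
  by_cases hb : π q₀ b = b
  · exact Or.inl ⟨b, fun q => (h1 q).trans hb⟩
  · refine Or.inr ⟨π q₀, fun q => ?_⟩
    have key : ∀ (σ σ' : Equiv.Perm (Fin 3)) (x y : Fin 3), x ≠ y → σ x = σ' x → σ y = σ' y →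
        σ = σ' := by decide
    exact key _ _ _ _ hb ((h2 q).trans (h2 q₀).symm) (h1 q)

lemma exists_sorted (x : Fin 3 → ℝ) :
    ∃ u v w : Fin 3, x u ≤ x v ∧ x v ≤ x w ∧ ∀ i, i = u ∨ i = v ∨ i = w := by
  rcases le_total (x 0) (x 1) with h | h <;> rcases le_total (x 1) (x 2) with h' | h' <;>
    rcases le_total (x 0) (x 2) with h'' | h''
  · exact ⟨0, 1, 2, h, h', by decide⟩
  · exact ⟨0, 1, 2, h, h', by decide⟩
  · exact ⟨0, 2, 1, h'', h', by decide⟩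
  · exact ⟨2, 0, 1, h'', h, by decide⟩
  · exact ⟨1, 0, 2, h, h'', by decide⟩
  · exact ⟨1, 2, 0, h', h'', by decide⟩
  · exact ⟨2, 1, 0, h', h, by decide⟩
  · exact ⟨2, 1, 0, h', h, by decide⟩

lemma sum_le_of_le_of_le {ι : Type*} [Fintype ι] (y : ι → ℝ) {M m : ℝ} (hM : ∀ i, y i ≤ M)
    {i₀ : ι} (hm : y i₀ ≤ m) : ∑ i, y i ≤ ((Fintype.card ι : ℝ) - 1) * M + m := by
  classical
  rw [← Finset.sum_erase_add _ _ (Finset.mem_univ i₀)]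
  refine add_le_add ?_ hm
  refine (Finset.sum_le_card_nsmul _ _ M fun i _ => hM i).trans_eq ?_
  rw [Finset.card_erase_of_mem (Finset.mem_univ _), nsmul_eq_mul, Finset.card_univ,
    Nat.cast_sub (Nat.succ_le_of_lt (Fintype.card_pos_iff.2 ⟨i₀⟩))]
  simp

/-- Averages of three numbers with non-constant selections differ by less than the numbers. -/
lemma sum_sub_sum_le {ι : Type*} [Fintype ι] (x : Fin 3 → ℝ) {δ : ℝ} (hδ : ∀ a b, x a - x b ≤ δ)
    {f g : ι → Fin 3} (hf : ∀ b, ∃ i, f i ≠ b) (hg : ∀ b, ∃ i, g i ≠ b) :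
    ∑ i, x (f i) - ∑ i, x (g i) ≤ ((Fintype.card ι : ℝ) - 1) * δ := by
  obtain ⟨u, v, w, huv, hvw, hall⟩ := exists_sorted x
  obtain ⟨i, hi⟩ := hf w
  obtain ⟨i', hi'⟩ := hg u
  -- The middle value `x v` bounds one term of each sum and cancels in the difference.
  have h1 := sum_le_of_le_of_le (fun i => x (f i)) (M := x w) (m := x v) (i₀ := i)
    (fun i => by rcases hall (f i) with h | h | h <;> rw [h] <;> linarith)
    (by
      rcases hall (f i) with h | h | h
      exacts [by rw [h]; exact huv, by rw [h], absurd h hi])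
  have h2 := sum_le_of_le_of_le (fun i => -x (g i)) (M := -x u) (m := -x v) (i₀ := i')
    (fun i => by rcases hall (g i) with h | h | h <;> rw [h] <;> linarith)
    (by
      rcases hall (g i') with h | h | h
      exacts [absurd h hi', by rw [h], by rw [h]; exact neg_le_neg hvw])
  rw [Finset.sum_neg_distrib] at h2
  have hc : (1 : ℝ) ≤ Fintype.card ι := by
    exact_mod_cast Fintype.card_pos_iff.2 ⟨i⟩
  have h3 := mul_le_mul_of_nonneg_left (hδ w u) (sub_nonneg.2 hc)
  linarith

/-- An approximate iteration of the average of eight permutations of three coordinates contracts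
their differences, unless the permutations have a common fixed coordinate or are all equal. -/
lemma tendsto_sub_of_average {π : Fin 8 → Equiv.Perm (Fin 3)}
    (hfix : ∀ a, ¬ ∀ q, π q a = a) (hconst : ∀ p, ¬ ∀ q, π q = p)
    {x : ℕ → Fin 3 → ℝ} (h0 : ∀ k a, 0 ≤ x k a) (h1 : ∀ k a, x k a ≤ 1)
    (hx : ∀ k a, |x (k + 1) a - (∑ q, x k ((π q).symm a)) / 8| ≤ (1 / 8) ^ k) (a b : Fin 3) :
    Tendsto (fun k => x k a - x k b) atTop (𝓝 0) := by
  have hne : ∀ a b, ∃ i : Fin 8 × Fin 8, (π i.2).symm ((π i.1).symm a) ≠ b := by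
    intro a b
    by_contra! h
    rcases perm_fixed_or_const (fun p q => h (q, p)) with ⟨c, hc⟩ | ⟨p, hp⟩
    exacts [hfix c hc, hconst p hp]
  have htwo : ∀ k a, |x (k + 2) a -
      (∑ i : Fin 8 × Fin 8, x k ((π i.2).symm ((π i.1).symm a))) / 64| ≤ 2 * (1 / 8) ^ k := by
    intro k a
    have hs : |(∑ q, x (k + 1) ((π q).symm a)) / 8 -
        (∑ i : Fin 8 × Fin 8, x k ((π i.2).symm ((π i.1).symm a))) / 64| ≤ (1 / 8) ^ k := by
      rw [Fintype.sum_prod_type, show (64 : ℝ) = 8 * 8 by norm_num, ← div_div, ← sub_div,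
        Finset.sum_div, ← Finset.sum_sub_distrib, abs_div, abs_of_pos (by norm_num : (0 : ℝ) < 8),
        div_le_iff₀ (by norm_num)]
      refine (Finset.abs_sum_le_sum_abs _ _).trans ?_
      refine (Finset.sum_le_card_nsmul _ _ _ fun q _ => hx k _).trans_eq ?_
      simp
      ring
    have hx' := hx (k + 1) a
    have hp : ((1 : ℝ) / 8) ^ (k + 1) ≤ (1 / 8) ^ k := by
      rw [pow_succ]
      have : (0 : ℝ) ≤ (1 / 8) ^ k := by positivity
      linarith
    calc _ ≤ _ := abs_sub_le _ ((∑ q, x (k + 1) ((π q).symm a)) / 8) _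
      _ ≤ _ := by linarith
  -- The recursion spans two levels, so two successive bounds are carried along. The constants
  -- satisfy (63/64) * 512 + 4 ≤ 512 * (255/256)^2, where 4 comes from the error 2 * (1/8)^k in each
  -- of two coordinates.
  have hbound : ∀ k, (∀ a b, x k a - x k b ≤ 512 * (255 / 256) ^ k) ∧
      ∀ a b, x (k + 1) a - x (k + 1) b ≤ 512 * (255 / 256) ^ (k + 1) := by
    intro k
    induction k with
    | zero =>
      constructor <;> intro a b
      · have := h1 0 a
        have := h0 0 b
        norm_num
        linarith
      · have := h1 1 a
        have := h0 1 b
        norm_num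
        linarith
    | succ k ih =>
      refine ⟨ih.2, fun a b => ?_⟩
      have hs := sum_sub_sum_le (x k) ih.1 (hne a) (hne b)
      have ha := abs_le.1 (htwo k a)
      have hb := abs_le.1 (htwo k b)
      have hp : ((1 : ℝ) / 8) ^ k ≤ (255 / 256) ^ k :=
        pow_le_pow_left₀ (by norm_num) (by norm_num) k
      have hpos : (0 : ℝ) < (255 / 256) ^ k := by positivity
      norm_num at hs
      rw [show k + 1 + 1 = k + 2 from rfl, pow_add]
      norm_num
      norm_num at ha hb hp
      linarith [ha.2, hb.1]
  have hlim : Tendsto (fun k : ℕ => (512 : ℝ) * (255 / 256) ^ k) atTop (𝓝 0) := by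
    rw [← mul_zero (512 : ℝ)]
    exact (tendsto_pow_atTop_nhds_zero_of_lt_one (by norm_num) (by norm_num)).const_mul _
  refine squeeze_zero_norm (fun k => ?_) hlim
  rw [Real.norm_eq_abs, abs_sub_le_iff]
  exact ⟨(hbound k).1 a b, (hbound k).1 b a⟩

/-! ### Edge counts and their recursion -/

lemma IsParallelToAxis.neg {d : ℕ} {j : Fin d} {v : Fin d → ℝ} (h : IsParallelToAxis j v) :
    IsParallelToAxis j (-v) :=
  ⟨neg_ne_zero.2 h.1, fun l hl => by simp [h.2 l hl]⟩

lemma isParallelToAxis_sub_comm {d : ℕ} {j : Fin d} {v w : Fin d → ℝ} :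
    IsParallelToAxis j (v - w) ↔ IsParallelToAxis j (w - v) :=
  ⟨fun h => neg_sub v w ▸ h.neg, fun h => neg_sub w v ▸ h.neg⟩

lemma isParallelToAxis_toSubcube_act {d : ℕ} (o : Fin d → ℤˣ) (γ : SignedPerm d) (j : Fin d)
    (x y : Fin d → ℝ) :
    IsParallelToAxis j (toSubcube o (γ.act x) - toSubcube o (γ.act y)) ↔
      IsParallelToAxis (γ.perm.symm j) (x - y) := by
  have h : ∀ l, (toSubcube o (γ.act x) - toSubcube o (γ.act y)) l = 0 ↔
      (x - y) (γ.perm.symm l) = 0 := by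
    intro l
    rw [← abs_eq_zero (a := (x - y) _), ← γ.abs_act, abs_eq_zero, γ.act_sub]
    simp only [toSubcube, Pi.sub_apply]
    constructor <;> intro h <;> linarith
  unfold IsParallelToAxis
  rw [Ne, h]
  refine and_congr Iff.rfl ⟨fun H l hl => ?_, fun H l hl => ?_⟩
  · have := (h (γ.perm l)).1 (H (γ.perm l) fun e => hl (by rw [← e, Equiv.symm_apply_apply]))
    rwa [Equiv.symm_apply_apply] at this
  · exact (h l).2 (H _ fun e => hl (γ.perm.symm.injective e))

open Classical in
/-- The indicator of the `i`-th edge of the `k`-th-order approximating curve being parallel to the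
`j`-th axis. -/
noncomputable def edgeIndicator {d : ℕ} (τ : ℝ → Fin d → ℝ) (k : ℕ) (j : Fin d) (i : ℕ) : ℕ :=
  if IsParallelToAxis j (vertex τ k (i + 1) - vertex τ k i) then 1 else 0

lemma edgeIndicator_congr {d : ℕ} {τ : ℝ → Fin d → ℝ} {k k' : ℕ} {j j' : Fin d} {i i' : ℕ}
    (h : IsParallelToAxis j (vertex τ k (i + 1) - vertex τ k i) ↔
      IsParallelToAxis j' (vertex τ k' (i' + 1) - vertex τ k' i')) :
    edgeIndicator τ k j i = edgeIndicator τ k' j' i' := by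
  classical
  unfold edgeIndicator
  exact if_congr h rfl rfl

lemma edgeIndicator_le_one {d : ℕ} (τ : ℝ → Fin d → ℝ) (k : ℕ) (j : Fin d) (i : ℕ) :
    edgeIndicator τ k j i ≤ 1 := by
  unfold edgeIndicator
  split_ifs <;> simp

lemma axisEdgeCount_eq {d : ℕ} {τ : ℝ → Fin d → ℝ} (hτ : IsHilbertCurve τ) (k : ℕ) (j : Fin d) :
    axisEdgeCount τ k j = ∑ i ∈ Finset.range (2 ^ (k * d) - 1), edgeIndicator τ k j i := by
  classical
  unfold edgeIndicator
  rw [Finset.sum_boole, Nat.cast_id, axisEdgeCount, ← Set.ncard_coe_finset]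
  congr 1
  ext i
  simp only [mem_ofPred_eq, Finset.coe_filter, Finset.mem_range, Nat.lt_sub_iff_add_lt]
  refine and_congr_right fun hi => ?_
  have h1 := hτ.vertex_spec k hi
  have h0 := hτ.vertex_spec k (Nat.lt_of_succ_lt hi)
  constructor
  · rintro ⟨p, q, hp, hq, h⟩
    rwa [h0.unique hp, h1.unique hq]
  · exact fun h => ⟨_, _, h0, h1, h⟩

lemma sum_axisEdgeCount {d : ℕ} {τ : ℝ → Fin d → ℝ} (hτ : IsHilbertCurve τ)
    (hface : IsFaceContinuous τ) (k : ℕ) : ∑ j, axisEdgeCount τ k j = 2 ^ (k * d) - 1 := by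
  classical
  simp only [axisEdgeCount_eq hτ]
  rw [Finset.sum_comm]
  have : ∀ i ∈ Finset.range (2 ^ (k * d) - 1), ∑ j, edgeIndicator τ k j i = 1 := by
    intro i hi
    rw [Finset.mem_range, Nat.lt_sub_iff_add_lt] at hi
    obtain ⟨j, hj, hl⟩ := vertex_adjacent hτ hface k hi
    have hne : (vertex τ k (i + 1) - vertex τ k i) j ≠ 0 := by
      intro h
      rw [Pi.sub_apply] at h
      rw [h, abs_zero] at hj
      exact absurd hj (by positivity)
    rw [Finset.sum_eq_single j]
    · rw [edgeIndicator, if_pos ⟨hne, fun l h => by rw [Pi.sub_apply, hl l h, sub_self]⟩]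
    · intro l _ h
      rw [edgeIndicator, if_neg fun hp => hne (hp.2 j h.symm)]
    · simp
  rw [Finset.sum_congr rfl this]
  simp

lemma sum_edgeIndicator_octant (hτ : IsHilbertCurve τ) (hD : IsSelfSimilar τ D) (k : ℕ)
    (q : Fin 8) (j : Fin 3) :
    ∑ r ∈ Finset.range (2 ^ (k * 3) - 1), edgeIndicator τ (k + 1) j (q * 2 ^ (k * 3) + r) =
      axisEdgeCount τ k ((D.symmetry q).perm.symm j) := by
  -- With N = 2 ^ (k * 3), reversal sends vertices r and r + 1 to N - 1 - r and N - 2 - r, hence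
  -- edge r to edge N - 2 - r.
  have h : ∀ r ∈ Finset.range (2 ^ (k * 3) - 1),
      edgeIndicator τ (k + 1) j (q * 2 ^ (k * 3) + r) =
        edgeIndicator τ k ((D.symmetry q).perm.symm j)
          (if D.reversed q then 2 ^ (k * 3) - 1 - 1 - r else r) := by
    intro r hr
    rw [Finset.mem_range, Nat.lt_sub_iff_add_lt] at hr
    refine edgeIndicator_congr ?_
    rw [add_assoc]
    have e1 := hτ.vertex_succ hD q hr
    have e0 := hτ.vertex_succ hD q (Nat.lt_of_succ_lt hr)
    erw [e1, e0]
    rw [isParallelToAxis_toSubcube_act]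
    cases D.reversed q
    · simp [flipIndex]
    · simp only [flipIndex, if_true]
      rw [isParallelToAxis_sub_comm, show 2 ^ (k * 3) - 1 - r = 2 ^ (k * 3) - 1 - 1 - r + 1 by omega,
        show 2 ^ (k * 3) - 1 - (r + 1) = 2 ^ (k * 3) - 1 - 1 - r by omega]
  rw [Finset.sum_congr rfl h, axisEdgeCount_eq hτ]
  cases D.reversed q
  · simp
  · simp only [if_true]
    exact Finset.sum_range_reflect _ _

lemma sum_range_mul_eq {f : ℕ → ℕ} (m n : ℕ) :
    ∑ i ∈ Finset.range (m * n), f i = ∑ q : Fin m, ∑ r ∈ Finset.range n, f (q * n + r) := by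
  induction m with
  | zero => simp
  | succ m ih =>
    rw [add_mul, one_mul, Finset.sum_range_add, ih, Fin.sum_univ_castSucc]
    simp

/-- Eight blocks of equal length include, besides the seven connecting edges, a spurious index after
the last vertex. Its indicator is unspecified but at most 1, which accounts for the slack 1 below
and 8 above. -/
lemma axisEdgeCount_succ (hτ : IsHilbertCurve τ) (hD : IsSelfSimilar τ D) (k : ℕ) (j : Fin 3) :
    ∑ q : Fin 8, axisEdgeCount τ k ((D.symmetry q).perm.symm j) ≤
        axisEdgeCount τ (k + 1) j + 1 ∧
      axisEdgeCount τ (k + 1) j ≤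
        ∑ q : Fin 8, axisEdgeCount τ k ((D.symmetry q).perm.symm j) + 8 := by
  set f := edgeIndicator τ (k + 1) j with hf
  have hN : 2 ^ (k * 3) = 2 ^ (k * 3) - 1 + 1 := by
    have : 0 < 2 ^ (k * 3) := by positivity
    omega
  have h8 : 2 ^ ((k + 1) * 3) = 8 * 2 ^ (k * 3) := by ring
  have h8' : 8 * 2 ^ (k * 3) = 8 * 2 ^ (k * 3) - 1 + 1 := by omega
  have h1 : ∑ i ∈ Finset.range (8 * 2 ^ (k * 3)), f i =
      axisEdgeCount τ (k + 1) j + f (8 * 2 ^ (k * 3) - 1) := by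
    rw [axisEdgeCount_eq hτ, h8, ← hf]
    conv_lhs => rw [h8', Finset.sum_range_succ]
  have h2 : ∑ i ∈ Finset.range (8 * 2 ^ (k * 3)), f i =
      ∑ q : Fin 8, axisEdgeCount τ k ((D.symmetry q).perm.symm j) +
        ∑ q : Fin 8, f (q * 2 ^ (k * 3) + (2 ^ (k * 3) - 1)) := by
    rw [sum_range_mul_eq, ← Finset.sum_add_distrib]
    refine Finset.sum_congr rfl fun q _ => ?_
    rw [← sum_edgeIndicator_octant hτ hD, ← Finset.sum_range_succ, ← hN]
  have h3 : ∑ q : Fin 8, f (q * 2 ^ (k * 3) + (2 ^ (k * 3) - 1)) ≤ 8 := by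
    refine (Finset.sum_le_card_nsmul _ _ 1 fun q _ => edgeIndicator_le_one _ _ _ _).trans_eq ?_
    simp
  have h4 : f (8 * 2 ^ (k * 3) - 1) ≤ 1 := edgeIndicator_le_one _ _ _ _
  omega

end HilbertCurve

/-! ### Edge-isotropy -/

open HilbertCurve in
theorem mainTheorem9 (τ : ℝ → Fin 3 → ℝ)
    (hτ : HilbertCurve.IsHilbertCurve τ) (hface : HilbertCurve.IsFaceContinuous τ) :
    HilbertCurve.IsEdgeIsotropic τ := by
  obtain ⟨D, hD⟩ := hτ.2.2
  obtain ⟨axis, hsigns⟩ := exists_gateSigns hτ hD hface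
  have hp : ∀ k : ℕ, (2 : ℝ) ^ (k * 3) = 8 ^ k := fun k => by
    rw [mul_comm, pow_mul]; norm_num
  have hsum : ∀ k, ∑ l, (axisEdgeCount τ k l : ℝ) = 8 ^ k - 1 := by
    intro k
    rw [← hp, ← Nat.cast_sum, sum_axisEdgeCount hτ hface, Nat.cast_sub Nat.one_le_two_pow]
    simp
  have hlim := tendsto_sub_of_average hsigns.not_fixed hsigns.not_const
    (x := fun k l => (axisEdgeCount τ k l : ℝ) / 8 ^ k) (fun k l => by positivity)
    (fun k l => by
      rw [div_le_one (by positivity)]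
      have := Finset.single_le_sum (f := fun l => (axisEdgeCount τ k l : ℝ))
        (fun _ _ => Nat.cast_nonneg _) (Finset.mem_univ l)
      linarith [hsum k])
    (fun k l => by
      obtain ⟨h1, h2⟩ := axisEdgeCount_succ hτ hD k l
      have h1' : ((∑ q : Fin 8, axisEdgeCount τ k ((D.symmetry q).perm.symm l) : ℕ) : ℝ) ≤
        axisEdgeCount τ (k + 1) l + 1 := by exact_mod_cast h1
      have h2' : (axisEdgeCount τ (k + 1) l : ℝ) ≤
        ((∑ q : Fin 8, axisEdgeCount τ k ((D.symmetry q).perm.symm l) : ℕ) : ℝ) + 8 := by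
        exact_mod_cast h2
      push_cast at h1' h2'
      rw [← Finset.sum_div, div_div, ← pow_succ, ← sub_div, abs_div,
        abs_of_pos (a := (8 : ℝ) ^ (k + 1)) (by positivity), div_le_iff₀ (by positivity),
        pow_succ, ← mul_assoc, ← mul_pow, abs_le]
      norm_num
      constructor <;> linarith)
  intro j
  have h8 : Tendsto (fun k : ℕ => (8 : ℝ) ^ k / (8 ^ k - 1)) atTop (𝓝 1) := by
    have h : Tendsto (fun k : ℕ => (1 - (1 / 8 : ℝ) ^ k)⁻¹) atTop (𝓝 (1 - 0)⁻¹) :=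
      (tendsto_const_nhds.sub
        (tendsto_pow_atTop_nhds_zero_of_lt_one (by norm_num) (by norm_num))).inv₀ (by norm_num)
    rw [sub_zero, inv_one] at h
    refine h.congr fun k => ?_
    rw [one_div, inv_pow, ← inv_div, sub_div, div_self (by positivity), one_div]
  -- Averaging the differences between coordinate `j` and all three coordinates gives x_k(j) - (8^k
  -- - 1) / (3 * 8^k); rescaling by 8^k / (8^k - 1) turns this into the edge fraction minus 1/3.
  have htot := ((((hlim j 0).add (hlim j 1)).add (hlim j 2)).div_const 3).mul h8
  have hfin := htot.add_const (1 / 3 : ℝ)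
  norm_num at hfin
  simp only [Nat.cast_ofNat, hp]
  norm_num
  refine hfin.congr' ?_
  -- At k = 0 there are no edges and the denominator vanishes.
  filter_upwards [eventually_ge_atTop 1] with k hk
  have hs := hsum k
  rw [Fin.sum_univ_three] at hs
  have hgt : (1 : ℝ) < 8 ^ k := one_lt_pow₀ (by norm_num) (by omega)
  have hne : (8 : ℝ) ^ k - 1 ≠ 0 := by linarith
  field_simp
  linarith
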